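/- Let $0\le q<1$ and let $\delta,M$ be constants. For $p\ge 2$ let $\mathcal U_p(q,\delta,M)$ be the set of positive definite $\Sigma=(\sigma_{ij})\in\mathbb R^{p\times p}$ with $\sigma_{ii}\le M$ and $\sum_{j=1}^p|\sigma_{ij}|^q\le\delta$ for all $i$ (for $q=0$ the sum counts nonzero entries, i.e. $0^0=0$ here). A sparsity pattern is a binary vector $m\in\{0,1\}^{p(p-1)/2}$ indexed by the pairs $i<j$; $|m|_1$ is its number of ones (edges). **Setting.** Given two independent samples of sizes $n_1$ and $n_2\ge1$, each i.i.d. from $N_p(0,\Sigma)$, let $\widehat\Sigma^{(1)},\widehat\Sigma^{(2)}$ be their empirical covariance matrices $\frac1{n_k}\sum_i x_ix_i^T$. For a pattern $m$ let $\widehat\Theta_m$ be the maximizer of $\log\det\Theta-\operatorname{tr}(\widehat\Sigma^{(1)}\Theta)$ over all $\Theta\succ0$ with $\theta_{ij}=0$ for each pair $i\neq j$ that is not an edge of $m$. For a nonempty deterministic set $\mathcal M$ of patterns put $$\pi_m=\frac1H\Bigl(\frac{|m|_1}{e\,p(p-1)}\Bigr)^{|m|_1}\ (0^0=1),\qquad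 \widehat S=\bigl(\hat\sigma^{(2)}_{ij}\mathbf 1(|\hat\sigma^{(2)}_{ij}|\ge\lambda)\bigr)_{i,j},\qquad \lambda=K\sqrt{\frac{\log p}{n_2}},$$ where $H$ makes $\sum_{m\in\mathcal M}\pi_m=1$, and $$\widehat\Theta_{\mathrm{gES}}=\sum_{m\in\mathcal M}v_m\widehat\Theta_m,\qquad v_m=\frac{\exp\{\frac{n_2}2(\log\det\widehat\Theta_m-\operatorname{tr}(\widehat\Theta_m\widehat S))\}\,\pi_m}{\sum_{m'\in\mathcal M}\exp\{\frac{n_2}2(\log\det\widehat\Theta_{m'}-\operatorname{tr}(\widehat\Theta_{m'}\widehat S))\}\,\pi_{m'}}.$$ Let $\mathrm{KL}(T)=R(T)-R(\Sigma^{-1})$ with $R(T)=\operatorname{tr}(T\Sigma)-\log\det T$, let $m^*\in\mathcal M$ be any minimizer of $m\mapsto\mathrm{KL}(\widehat\Theta_m)$, and let $s^*=|m^*|_1$. **Theorem.** There is $K_0=K_0(q,\delta,M)>0$ such that the following holds for every $K\ge K_0$. Let $p=p_t\ge2$, $n_1=n_{1,t}$, $n_2=n_{2,t}\ge1$, $\mathcal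 M=\mathcal M_t\neq\emptyset$ be sequences indexed by $t\in\mathbb N$ with $\log p/n_2\to0$ as $t\to\infty$, and let $\mathcal S_t\subset\mathcal U_{p}(q,\delta,M)$ be classes of covariance matrices such that for every $\Sigma\in\mathcal S_t$, almost surely, each $\widehat\Theta_m$, $m\in\mathcal M$, exists and is unique. Suppose that, uniformly over $\Sigma\in\mathcal S_t$, $$\max_{m\in\mathcal M}\operatorname{tr}(\widehat\Theta_m)=O_P(p).$$ Then, uniformly over $\Sigma\in\mathcal S_t$, $$\mathrm{KL}(\widehat\Theta_{\mathrm{gES}})-\min_{m\in\mathcal M}\mathrm{KL}(\widehat\Theta_m)\le O_P\!\left(\frac{s^*\log p}{n_2}+p\Bigl(\frac{\log p}{n_2}\Bigr)^{(1-q)/2}\right).$$ Here $Y\le O_P(r)$ uniformly over $\mathcal S_t$ means: for every $\varepsilon>0$ there is $C>0$ such that for all sufficiently large $t$, $\sup_{\Sigma\in\mathcal S_t}\mathbb P_\Sigma(Y>C\,r)\le\varepsilon$; the rate $r$ may be random. In particular, with $\mathcal S_t=\{\Sigma_t\}$, this covers every sequence $\Sigma_t\in\mathcal U_p(q,\delta,M)$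 along which the trace assumption holds. -/

import Mathlib

open MeasureTheory ProbabilityTheory Filter Topology

noncomputable section

namespace GES

/-! ### Sparsity patterns -/

/-- The list of unordered pairs of vertices, `{(i, j) : i < j}`. -/
abbrev Pair (p : ℕ) : Type := {e : Fin p × Fin p // e.1 < e.2}

/-- A sparsity pattern: a binary vector indexed by the `p (p - 1) / 2` pairs, `true` meaning that
the edge is present. -/
abbrev Pattern (p : ℕ) : Type := Pair p → Bool

/-- `|m|₁`, the number of edges of the pattern. -/
def Pattern.size {p : ℕ} (m : Pattern p) : ℕ := (Finset.univ.filter (fun e => m e = true)).card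

/-! ### Gaussian samples and empirical covariance -/

/-- A sample split into a first part of size `n₁` and a second part of size `n₂`. -/
abbrev Sample (p n₁ n₂ : ℕ) : Type :=
  (Fin n₁ → EuclideanSpace ℝ (Fin p)) × (Fin n₂ → EuclideanSpace ℝ (Fin p))

/-- The law of the split sample: all `n₁ + n₂` observations are independent with law `N_p(0, Σ)`. -/
def sampleLaw (p n₁ n₂ : ℕ) (Sig : Matrix (Fin p) (Fin p) ℝ) : Measure (Sample p n₁ n₂) :=
  (Measure.pi fun _ : Fin n₁ => multivariateGaussian 0 Sig).prod
    (Measure.pi fun _ : Fin n₂ => multivariateGaussian 0 Sig)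

/-- The empirical covariance matrix `n⁻¹ ∑ x_k x_kᵀ`. -/
def empCov {p n : ℕ} (x : Fin n → EuclideanSpace ℝ (Fin p)) : Matrix (Fin p) (Fin p) ℝ :=
  Matrix.of fun i j => (n : ℝ)⁻¹ * ∑ k, x k i * x k j

open Classical in
/-- Hard thresholding of the entries of a matrix at level `γ`. -/
def hardThreshold {p : ℕ} (γ : ℝ) (A : Matrix (Fin p) (Fin p) ℝ) : Matrix (Fin p) (Fin p) ℝ :=
  Matrix.of fun i j => if γ ≤ |A i j| then A i j else 0

/-! ### Individual estimators -/

/-- `log det Θ`, used for positive definite `Θ`. -/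
def logdet {p : ℕ} (T : Matrix (Fin p) (Fin p) ℝ) : ℝ := Real.log T.det

/-- The cone of positive definite matrices whose off-diagonal entries vanish off the edges of the
pattern. By symmetry it is enough to constrain the entries above the diagonal. -/
def constraintSet {p : ℕ} (m : Pattern p) : Set (Matrix (Fin p) (Fin p) ℝ) :=
  {T | T.PosDef ∧ ∀ e : Pair p, m e = false → T e.1.1 e.1.2 = 0}

/-- `T` is a constrained maximum likelihood estimator for the pattern `m` and the empirical
covariance matrix `A`. -/
def IsCMLE {p : ℕ} (A : Matrix (Fin p) (Fin p) ℝ) (m : Pattern p)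
    (T : Matrix (Fin p) (Fin p) ℝ) : Prop :=
  T ∈ constraintSet m ∧
    ∀ T' ∈ constraintSet m, logdet T' - (A * T').trace ≤ logdet T - (A * T).trace

open Classical in
/-- The constrained maximum likelihood estimator (with the value `0` if there is none). -/
def cmle {p : ℕ} (A : Matrix (Fin p) (Fin p) ℝ) (m : Pattern p) : Matrix (Fin p) (Fin p) ℝ :=
  if h : ∃ T, IsCMLE A m T then h.choose else 0

/-! ### The graphical exponential screening estimator -/

/-- The unnormalized prior `(|m|₁ / (e p (p - 1))) ^ |m|₁`, with `0 ^ 0 = 1`. -/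
def priorMass {p : ℕ} (m : Pattern p) : ℝ :=
  ((m.size : ℝ) / (Real.exp 1 * p * ((p : ℝ) - 1))) ^ m.size

/-- The prior `π_m` on the dictionary `D`. -/
def prior {p : ℕ} (D : Finset (Pattern p)) (m : Pattern p) : ℝ :=
  priorMass m / ∑ m' ∈ D, priorMass m'

/-- The unnormalized aggregation weight of the pattern `m`; `A` is the first empirical covariance
matrix and `S` the covariance estimate from the second subsample, of size `n₂`. -/
def rawWeight {p : ℕ} (D : Finset (Pattern p)) (n₂ : ℕ) (A S : Matrix (Fin p) (Fin p) ℝ)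
    (m : Pattern p) : ℝ :=
  Real.exp (((n₂ : ℝ) / 2) * (logdet (cmle A m) - (cmle A m * S).trace)) * prior D m

/-- The aggregation weight `v_m`. -/
def weight {p : ℕ} (D : Finset (Pattern p)) (n₂ : ℕ) (A S : Matrix (Fin p) (Fin p) ℝ)
    (m : Pattern p) : ℝ :=
  rawWeight D n₂ A S m / ∑ m' ∈ D, rawWeight D n₂ A S m'

/-- The aggregate `∑ v_m Θ̂_m`. -/
def aggregate {p : ℕ} (D : Finset (Pattern p)) (n₂ : ℕ) (A S : Matrix (Fin p) (Fin p) ℝ) :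
    Matrix (Fin p) (Fin p) ℝ :=
  ∑ m ∈ D, weight D n₂ A S m • cmle A m

/-- The individual estimator `Θ̂_m`, computed from the first subsample. -/
def indiv {p n₁ n₂ : ℕ} (x : Sample p n₁ n₂) (m : Pattern p) : Matrix (Fin p) (Fin p) ℝ :=
  cmle (empCov x.1) m

/-- The gES estimator with the second empirical covariance matrix hard-thresholded at `γ`. -/
def gES {p n₁ n₂ : ℕ} (D : Finset (Pattern p)) (γ : ℝ) (x : Sample p n₁ n₂) :
    Matrix (Fin p) (Fin p) ℝ :=
  aggregate D n₂ (empCov x.1) (hardThreshold γ (empCov x.2))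

/-! ### Risk and covariance class -/

/-- The risk `R(T) = tr(T Σ) - log det T`. -/
def risk {p : ℕ} (Sig T : Matrix (Fin p) (Fin p) ℝ) : ℝ := (T * Sig).trace - logdet T

/-- The Kullback-Leibler risk `R(T) - R(Σ⁻¹)`. -/
def KL {p : ℕ} (Sig T : Matrix (Fin p) (Fin p) ℝ) : ℝ := risk Sig T - risk Sig Sig⁻¹

open Classical in
/-- The class `U(q, δ, M)`; the `if` implements `0 ^ 0 = 0`, so that for `q = 0` the sum counts the
nonzero entries of the row. -/
def covClass (p : ℕ) (q δ M : ℝ) : Set (Matrix (Fin p) (Fin p) ℝ) :=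
  {Sig | Sig.PosDef ∧ ∀ i, Sig i i ≤ M ∧
    ∑ j, (if Sig i j = 0 then 0 else |Sig i j| ^ q) ≤ δ}

/-! ### Uniform stochastic order -/

/-- `Y ≤ O_P(r)` along the sequence `t → ∞`, uniformly over the parameters `θ ∈ S t`, where under
`θ` the data have the law `P t θ`; the rate `r` may itself be random. -/
def UniformlyLeBigOP {Θ Ω : ℕ → Type} [∀ t, MeasurableSpace (Ω t)] (S : ∀ t, Set (Θ t))
    (P : ∀ t, Θ t → Measure (Ω t)) (Y r : ∀ t, Θ t → Ω t → ℝ) : Prop :=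
  ∀ ε : ℝ, 0 < ε → ∃ C : ℝ, 0 < C ∧ ∀ᶠ t in atTop, ∀ θ ∈ S t,
    P t θ {ω | C * r t θ ω < Y t θ ω} ≤ ENNReal.ofReal ε

end GES

end

/-! Write `S` for the thresholded covariance. The weights are Gibbs weights at inverse temperature
`n₂ / 2` for the empirical risk `risk S`. Concavity of `log det` bounds the aggregate's empirical
risk by the weighted average. The Gibbs variational principle bounds that average by the risk of any
`m₀` plus `(2 / n₂) * -log π(m₀)`. The prior makes this cost of order `s log p / n₂`
(`risk_aggregate_le`).

Replacing `S` by `Σ` changes the risk of `T` by `tr(T (S - Σ))`, at most `tr T` times the largest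
row `ℓ¹`-norm of `S - Σ` (`abs_trace_mul_le`). All traces are at most of order `p` by assumption,
and convex combination preserves this bound, so the oracle inequality is deterministic on an event
about `S - Σ` and the traces (`KL_aggregate_sub_le`).

For the rows of `S - Σ`, a Chernoff bound for products of Gaussian coordinates controls all entries
of the empirical covariance. Thresholding then turns `ℓ^q`-sparsity into row errors of order `(log p
/ n₂)^((1 - q) / 2)`. Since `K` may not depend on `ε`, noise below half the threshold is likely
enough only for large `p`. For `p` bounded in terms of `ε`, a crude row bound with a factor `p`
suffices (`exists_noise_level`). -/

namespace GES

/-! ### Concavity of `log det` and trace duality -/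

section Matrices

variable {p : ℕ}

theorem logdet_le_trace_sub {C : Matrix (Fin p) (Fin p) ℝ} (hC : C.PosDef) :
    logdet C ≤ C.trace - p := by
  have hd := hC.isHermitian.det_eq_prod_eigenvalues
  have ht := hC.isHermitian.trace_eq_sum_eigenvalues
  simp only [RCLike.ofReal_real_eq_id, id] at hd ht
  have hpos := fun i => hC.eigenvalues_pos i
  rw [logdet, hd, ht, Real.log_prod (fun i _ => (hpos i).ne')]
  calc ∑ i, Real.log (hC.isHermitian.eigenvalues i)
      ≤ ∑ i, (hC.isHermitian.eigenvalues i - 1) :=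
        Finset.sum_le_sum fun i _ => Real.log_le_sub_one_of_pos (hpos i)
    _ = _ := by simp [Finset.sum_sub_distrib]

/-- The tangent inequality expressing the concavity of `log det` on positive definite matrices. -/
theorem logdet_le_logdet_add_trace {A B : Matrix (Fin p) (Fin p) ℝ} (hA : A.PosDef)
    (hB : B.PosDef) : logdet B ≤ logdet A + ((A⁻¹ * B).trace - p) := by
  open scoped MatrixOrder in
  -- `A⁻¹ * B` need not be symmetric; with `A⁻¹ = Lᵀ L`, the matrix `L B Lᵀ` is positive definite
  -- and has the same trace and determinant.
  obtain ⟨L, hL⟩ := CStarAlgebra.nonneg_iff_eq_star_mul_self.mp hA.inv.posSemidef.nonneg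
  have hLL : A⁻¹ = L.conjTranspose * L := hL
  have hdet : A⁻¹.det = L.det * L.det := by
    rw [hLL, Matrix.det_mul, Matrix.det_conjTranspose]; simp
  have hLdet : L.det ≠ 0 := by
    intro h
    have := hA.inv.det_pos
    rw [hdet, h] at this; simp at this
  have hLu : IsUnit L := (Matrix.isUnit_iff_isUnit_det L).2 (isUnit_iff_ne_zero.2 hLdet)
  have hC : (L * B * L.conjTranspose).PosDef :=
    hB.mul_mul_conjTranspose_same (Matrix.vecMul_injective_of_isUnit hLu)
  have h := logdet_le_trace_sub hC
  have hCdet : (L * B * L.conjTranspose).det = A⁻¹.det * B.det := by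
    rw [hdet, Matrix.det_mul, Matrix.det_mul, Matrix.det_conjTranspose]; simp; ring
  have hCtr : (L * B * L.conjTranspose).trace = (A⁻¹ * B).trace := by
    rw [hLL, Matrix.trace_mul_comm, ← Matrix.mul_assoc]
  rw [hCtr, logdet, hCdet, Real.log_mul hA.inv.det_pos.ne' hB.det_pos.ne', Matrix.det_nonsing_inv,
    Ring.inverse_eq_inv', Real.log_inv] at h
  unfold logdet
  linarith

theorem posDef_sum_smul {ι : Type*} {D : Finset ι} {v : ι → ℝ} {T : ι → Matrix (Fin p) (Fin p) ℝ}
    (hD : D.Nonempty) (hv : ∀ m ∈ D, 0 < v m) (hT : ∀ m ∈ D, (T m).PosDef) :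
    (∑ m ∈ D, v m • T m).PosDef := by
  induction hD using Finset.Nonempty.cons_induction with
  | singleton a => simpa using (hT a (by simp)).smul (hv a (by simp))
  | cons a s ha hs ih =>
    rw [Finset.sum_cons]
    refine ((hT a (by simp)).smul (hv a (by simp))).add (ih ?_ ?_)
    · exact fun m hm => hv m (by simp [hm])
    · exact fun m hm => hT m (by simp [hm])

/-- Jensen's inequality for `log det`. -/
theorem sum_logdet_le_logdet_sum {ι : Type*} {D : Finset ι} {v : ι → ℝ}
    {T : ι → Matrix (Fin p) (Fin p) ℝ} (hD : D.Nonempty) (hv : ∀ m ∈ D, 0 < v m)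
    (hv1 : ∑ m ∈ D, v m = 1) (hT : ∀ m ∈ D, (T m).PosDef) :
    ∑ m ∈ D, v m * logdet (T m) ≤ logdet (∑ m ∈ D, v m • T m) := by
  set A := ∑ m ∈ D, v m • T m with hAdef
  have hA : A.PosDef := posDef_sum_smul hD hv hT
  have hAA : A⁻¹ * A = 1 := Matrix.nonsing_inv_mul _ (isUnit_iff_ne_zero.2 hA.det_pos.ne')
  -- The tangent is taken at the mean `A`, so the linear terms average out: `tr(A⁻¹ A) = p`.
  have htr : ∑ m ∈ D, v m * (A⁻¹ * T m).trace = p := by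
    have : ∑ m ∈ D, v m * (A⁻¹ * T m).trace = (A⁻¹ * A).trace := by
      rw [show (A⁻¹ * A).trace = (A⁻¹ * ∑ m ∈ D, v m • T m).trace from rfl, Matrix.mul_sum,
        Matrix.trace_sum]
      simp
    rw [this, hAA]; simp
  calc ∑ m ∈ D, v m * logdet (T m)
      ≤ ∑ m ∈ D, v m * (logdet A + ((A⁻¹ * T m).trace - p)) :=
        Finset.sum_le_sum fun m hm => mul_le_mul_of_nonneg_left
          (logdet_le_logdet_add_trace hA (hT m hm)) (hv m hm).le
    _ = (∑ m ∈ D, v m) * (logdet A - p) + ∑ m ∈ D, v m * (A⁻¹ * T m).trace := by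
        rw [Finset.sum_mul, ← Finset.sum_add_distrib]
        exact Finset.sum_congr rfl fun m _ => by ring
    _ = logdet A := by rw [hv1, htr]; ring

/-- The quadratic form is nonnegative at `e_i + e_j` and `e_i - e_j`. -/
theorem abs_apply_le_of_posSemidef {T : Matrix (Fin p) (Fin p) ℝ} (hT : T.PosSemidef)
    (i j : Fin p) : |T i j| ≤ (T i i + T j j) / 2 := by
  have hsymm : T j i = T i j := by simpa using hT.isHermitian.apply i j
  have key : ∀ s : ℝ, s * s = 1 → 0 ≤ T i i + T j j + 2 * s * T i j := by
    intro s hs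
    have h := hT.dotProduct_mulVec_nonneg (Pi.single i 1 + s • Pi.single j 1)
    simp only [star_trivial, Matrix.mulVec_add, Matrix.mulVec_smul, add_dotProduct,
      dotProduct_add, smul_dotProduct, dotProduct_smul, Matrix.mulVec_single_one, Matrix.col_apply,
      single_one_dotProduct, smul_eq_mul, hsymm] at h
    linear_combination h + T j j * hs
  rw [abs_le]
  constructor
  · linarith [key 1 (by norm_num)]
  · linarith [key (-1) (by norm_num)]

/-- Bounding `|T i j|` by the mean of two diagonal entries leaves row and column sums of `|E|`
weighted by the diagonal of `T`; symmetry of `E` identifies the two. -/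
theorem abs_trace_mul_le {T E : Matrix (Fin p) (Fin p) ℝ} {B : ℝ} (hT : T.PosSemidef)
    (hE : ∀ i j, E i j = E j i) (hB : ∀ i, ∑ j, |E i j| ≤ B) :
    |(T * E).trace| ≤ T.trace * B := by
  have hd : ∀ i, 0 ≤ T i i := fun i => by
    have := abs_apply_le_of_posSemidef hT i i
    linarith [abs_nonneg (T i i)]
  calc |(T * E).trace| = |∑ i, ∑ j, T i j * E j i| := by
        simp [Matrix.trace, Matrix.mul_apply]
    _ ≤ ∑ i, ∑ j, |T i j * E j i| := (Finset.abs_sum_le_sum_abs _ _).trans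
        (Finset.sum_le_sum fun i _ => Finset.abs_sum_le_sum_abs _ _)
    _ ≤ ∑ i, ∑ j, (T i i * |E i j| / 2 + T j j * |E j i| / 2) := by
        refine Finset.sum_le_sum fun i _ => Finset.sum_le_sum fun j _ => ?_
        rw [abs_mul, hE i j]
        have := mul_le_mul_of_nonneg_right (abs_apply_le_of_posSemidef hT i j) (abs_nonneg (E j i))
        linarith
    _ = ∑ i, T i i * ∑ j, |E i j| := by
        simp only [Finset.sum_add_distrib]
        rw [Finset.sum_comm (f := fun i j => T j j * |E j i| / 2), ← Finset.sum_add_distrib]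
        refine Finset.sum_congr rfl fun i _ => ?_
        rw [Finset.mul_sum, ← Finset.sum_add_distrib]
        exact Finset.sum_congr rfl fun j _ => by ring
    _ ≤ ∑ i, T i i * B := Finset.sum_le_sum fun i _ => mul_le_mul_of_nonneg_left (hB i) (hd i)
    _ = T.trace * B := by simp [Matrix.trace, Finset.sum_mul]

end Matrices

/-! ### Normalization and logarithmic cost of the prior -/

section Prior

variable {p : ℕ}

theorem card_pair_mul_two (p : ℕ) : Fintype.card (Pair p) * 2 = p * (p - 1) := by
  rw [Fintype.card_subtype]
  rw [Fintype.card_product_filter_lt, Fintype.card_fin, Nat.choose_two_right]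
  exact Nat.div_mul_cancel (Nat.even_mul_pred_self p).two_dvd

theorem priorMass_pos (hp : 2 ≤ p) (m : Pattern p) : 0 < priorMass m := by
  have hp' : (2 : ℝ) ≤ p := by exact_mod_cast hp
  unfold priorMass
  rcases Nat.eq_zero_or_pos m.size with h | h
  · simp [h]
  · have : (0 : ℝ) < m.size := by exact_mod_cast h
    have : (0 : ℝ) < (p : ℝ) - 1 := by linarith
    positivity

/-- `N.choose k ≤ N ^ k / k!` and `k ^ k / k! ≤ e ^ k`; the denominator `2 e N = e p (p - 1)` is
chosen to leave `2 ^ (-k)`. -/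
theorem choose_mul_pow_le (N k : ℕ) :
    (N.choose k : ℝ) * ((k : ℝ) / (2 * Real.exp 1 * N)) ^ k ≤ (1 / 2) ^ k := by
  rcases Nat.eq_zero_or_pos N with rfl | hN
  · rcases Nat.eq_zero_or_pos k with rfl | hk
    · simp
    · simp [hk.ne']
  have hN' : (0 : ℝ) < N := by exact_mod_cast hN
  have hf : (0 : ℝ) < (k.factorial : ℝ) := by exact_mod_cast k.factorial_pos
  have hk : (k : ℝ) ^ k / k.factorial ≤ Real.exp 1 ^ k := by
    have := Real.pow_div_factorial_le_exp (x := k) (Nat.cast_nonneg _) k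
    rwa [← Real.exp_one_pow] at this
  calc (N.choose k : ℝ) * ((k : ℝ) / (2 * Real.exp 1 * N)) ^ k
      ≤ (N : ℝ) ^ k / k.factorial * ((k : ℝ) / (2 * Real.exp 1 * N)) ^ k := by
        gcongr
        exact Nat.choose_le_pow_div k N
    _ = ((k : ℝ) ^ k / k.factorial) * ((1 / 2) ^ k / Real.exp 1 ^ k) := by
        rw [div_pow, mul_pow, mul_pow, one_div, inv_pow]
        field_simp
    _ ≤ Real.exp 1 ^ k * ((1 / 2) ^ k / Real.exp 1 ^ k) := by gcongr
    _ = (1 / 2) ^ k := by field_simp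

/-- Grouping patterns by size leaves a geometric series, so the normalizer is bounded independently
of `p` and of the dictionary. -/
theorem sum_priorMass_le_two (hp : 2 ≤ p) (D : Finset (Pattern p)) :
    ∑ m ∈ D, priorMass m ≤ 2 := by
  set N := Fintype.card (Pair p)
  have hN : Real.exp 1 * p * ((p : ℝ) - 1) = 2 * Real.exp 1 * N := by
    have h : ((N * 2 : ℕ) : ℝ) = ((p * (p - 1) : ℕ) : ℝ) := by rw [card_pair_mul_two p]
    rw [Nat.cast_mul, Nat.cast_mul, Nat.cast_sub (by omega)] at h
    push_cast at h
    linear_combination (-Real.exp 1) * h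
  let g : ℕ → ℝ := fun k => ((k : ℝ) / (2 * Real.exp 1 * N)) ^ k
  have hg : ∀ m : Pattern p, priorMass m = g m.size := fun m => by
    simp only [priorMass, g, hN]
  let toSet : Pattern p ≃ Finset (Pair p) :=
    { toFun := fun m => Finset.univ.filter fun e => m e = true
      invFun := fun s e => decide (e ∈ s)
      left_inv := fun m => by ext e; simp
      right_inv := fun s => by ext e; simp }
  calc ∑ m ∈ D, priorMass m ≤ ∑ m : Pattern p, priorMass m :=
        Finset.sum_le_sum_of_subset_of_nonneg (Finset.subset_univ _)
          fun m _ _ => (priorMass_pos hp m).le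
    _ = ∑ s : Finset (Pair p), g s.card := by
        refine Fintype.sum_equiv toSet _ _ fun m => ?_
        rw [hg]; rfl
    _ = ∑ k ∈ Finset.range (N + 1), (N.choose k : ℝ) * g k := by
        rw [← Finset.powerset_univ, Finset.sum_powerset_apply_card]
        simp [N, Finset.card_univ]
    _ ≤ ∑ k ∈ Finset.range (N + 1), (1 / 2 : ℝ) ^ k :=
        Finset.sum_le_sum fun k _ => choose_mul_pow_le N k
    _ ≤ 2 := by
        have := (summable_geometric_two).sum_le_tsum (Finset.range (N + 1)) (fun _ _ => by positivity)
        rwa [tsum_geometric_two] at this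

theorem prior_pos (hp : 2 ≤ p) {D : Finset (Pattern p)} (hD : D.Nonempty) (m : Pattern p) :
    0 < prior D m :=
  div_pos (priorMass_pos hp m) (Finset.sum_pos (fun m _ => priorMass_pos hp m) hD)

theorem sum_prior (hp : 2 ≤ p) {D : Finset (Pattern p)} (hD : D.Nonempty) :
    ∑ m ∈ D, prior D m = 1 := by
  unfold prior
  rw [← Finset.sum_div]
  exact div_self (Finset.sum_pos (fun m _ => priorMass_pos hp m) hD).ne'

theorem neg_log_prior_le (hp : 2 ≤ p) {D : Finset (Pattern p)} (hD : D.Nonempty)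
    (m : Pattern p) :
    -Real.log (prior D m) ≤ 4 * (m.size * Real.log p) + Real.log 2 := by
  have hp' : (2 : ℝ) ≤ p := by exact_mod_cast hp
  have hH := Finset.sum_pos (fun m _ => priorMass_pos hp m) hD
  have hlogH := Real.log_le_log hH (sum_priorMass_le_two hp D)
  have hlp : Real.log 2 ≤ Real.log p := Real.log_le_log (by norm_num) hp'
  have hl2 := Real.log_two_gt_d9
  rw [prior, Real.log_div (priorMass_pos hp m).ne' hH.ne']
  suffices h : -Real.log (priorMass m) ≤ 4 * (m.size * Real.log p) by linarith
  unfold priorMass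
  rcases Nat.eq_zero_or_pos m.size with h | h
  · simp [h]
  have hs : (1 : ℝ) ≤ m.size := by exact_mod_cast h
  have hp1 : (0 : ℝ) < (p : ℝ) - 1 := by linarith
  rw [Real.log_pow, Real.log_div (by positivity) (by positivity),
    Real.log_mul (by positivity) hp1.ne', Real.log_mul (by positivity) (by positivity),
    Real.log_exp]
  have h1 : Real.log ((p : ℝ) - 1) ≤ Real.log p := Real.log_le_log hp1 (by linarith)
  have h2 : 0 ≤ Real.log (m.size : ℝ) := Real.log_nonneg hs
  -- The cost per edge is at most `1 + 2 log p`, and `1 ≤ 2 log p` because `log 2 > 1 / 2`.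
  nlinarith

end Prior

/-! ### Exponential weights and the deterministic oracle inequality -/

section Oracle

variable {p : ℕ}

/-- The variational bound for exponential weights. -/
theorem sum_gibbs_mul_le {ι : Type*} {D : Finset ι} {π f w : ι → ℝ} {c : ℝ} (hc : 0 < c)
    (hD : D.Nonempty) (hπ : ∀ m ∈ D, 0 < π m) (hπ1 : ∑ m ∈ D, π m = 1)
    (hw : ∀ m ∈ D, w m = Real.exp (-(c * f m)) * π m) {m₀ : ι} (hm₀ : m₀ ∈ D) :
    ∑ m ∈ D, w m / (∑ m' ∈ D, w m') * f m ≤ f m₀ + c⁻¹ * -Real.log (π m₀) := by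
  set Z := ∑ m' ∈ D, w m' with hZ
  have hwpos : ∀ m ∈ D, 0 < w m := fun m hm => by
    rw [hw m hm]; exact mul_pos (Real.exp_pos _) (hπ m hm)
  have hZpos : 0 < Z := Finset.sum_pos hwpos hD
  have hv1 : ∑ m ∈ D, w m / Z = 1 := by rw [← Finset.sum_div, div_self hZpos.ne']
  -- Keeping only the term `m₀` of `Z` corresponds to a point mass as competitor.
  have hZge : -(c * f m₀) + Real.log (π m₀) ≤ Real.log Z := by
    have h1 : w m₀ ≤ Z := Finset.single_le_sum (fun m hm => (hwpos m hm).le) hm₀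
    have h2 := Real.log_le_log (hwpos _ hm₀) h1
    rwa [hw _ hm₀, Real.log_mul (Real.exp_pos _).ne' (hπ _ hm₀).ne', Real.log_exp] at h2
  -- With `v = w / Z`, `log (π / v) = c f + log Z`; the sum of these bounds is nonnegativity of the
  -- divergence of `v` from `π`.
  have hterm : ∀ m ∈ D, w m / Z * (c * f m) ≤ π m - w m / Z - w m / Z * Real.log Z := by
    intro m hm
    have hv : 0 < w m / Z := div_pos (hwpos m hm) hZpos
    have hπm := hπ m hm
    have h1 := Real.log_le_sub_one_of_pos (div_pos hπm hv)
    rw [Real.log_div hπm.ne' hv.ne', Real.log_div (hwpos m hm).ne' hZpos.ne', hw m hm,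
      Real.log_mul (Real.exp_pos _).ne' hπm.ne', Real.log_exp, ← hw m hm] at h1
    have h2 := mul_le_mul_of_nonneg_left h1 hv.le
    have h3 : w m / Z * (π m / (w m / Z)) = π m := mul_div_cancel₀ _ hv.ne'
    linarith [h2, h3]
  have hsum := Finset.sum_le_sum hterm
  rw [Finset.sum_sub_distrib, Finset.sum_sub_distrib, ← Finset.sum_mul, hπ1, hv1] at hsum
  have hfac : ∑ m ∈ D, w m / Z * (c * f m) = c * ∑ m ∈ D, w m / Z * f m := by
    rw [Finset.mul_sum]; exact Finset.sum_congr rfl fun m _ => by ring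
  rw [hfac] at hsum
  have : c * ∑ m ∈ D, w m / Z * f m ≤ c * (f m₀ + c⁻¹ * -Real.log (π m₀)) := by
    rw [mul_add, ← mul_assoc, mul_inv_cancel₀ hc.ne']
    linarith
  exact le_of_mul_le_mul_left this hc

theorem rawWeight_pos (hp : 2 ≤ p) {D : Finset (Pattern p)} (hD : D.Nonempty) {n : ℕ}
    {A S : Matrix (Fin p) (Fin p) ℝ} (m : Pattern p) : 0 < rawWeight D n A S m :=
  mul_pos (Real.exp_pos _) (prior_pos hp hD m)

theorem weight_pos (hp : 2 ≤ p) {D : Finset (Pattern p)} (hD : D.Nonempty) {n : ℕ}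
    {A S : Matrix (Fin p) (Fin p) ℝ} (m : Pattern p) : 0 < weight D n A S m :=
  div_pos (rawWeight_pos hp hD m) (Finset.sum_pos (fun m _ => rawWeight_pos hp hD m) hD)

theorem sum_weight (hp : 2 ≤ p) {D : Finset (Pattern p)} (hD : D.Nonempty) {n : ℕ}
    {A S : Matrix (Fin p) (Fin p) ℝ} : ∑ m ∈ D, weight D n A S m = 1 := by
  unfold weight
  rw [← Finset.sum_div, div_self (Finset.sum_pos (fun m _ => rawWeight_pos hp hD m) hD).ne']

/-- The empirical oracle inequality: the aggregate is compared with a member of the dictionary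
in terms of the risk in which `Σ` is replaced by its estimate `S`. -/
theorem risk_aggregate_le (hp : 2 ≤ p) {D : Finset (Pattern p)} (hD : D.Nonempty) {n : ℕ}
    (hn : 0 < n) {A S : Matrix (Fin p) (Fin p) ℝ} (hT : ∀ m ∈ D, (cmle A m).PosDef)
    {m₀ : Pattern p} (hm₀ : m₀ ∈ D) :
    risk S (aggregate D n A S) ≤
      risk S (cmle A m₀) + 2 / n * (4 * (m₀.size * Real.log p) + Real.log 2) := by
  have hn' : (0 : ℝ) < n := by exact_mod_cast hn
  have hc : (0 : ℝ) < n / 2 := by positivity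
  have hgibbs := sum_gibbs_mul_le (D := D) (π := prior D) (f := fun m => risk S (cmle A m))
    (w := rawWeight D n A S) hc hD (fun m _ => prior_pos hp hD m) (sum_prior hp hD)
    (fun m _ => by simp only [rawWeight, risk]; congr 2; ring) hm₀
  have hconv : risk S (aggregate D n A S) ≤ ∑ m ∈ D, weight D n A S m * risk S (cmle A m) := by
    have h := sum_logdet_le_logdet_sum (T := fun m => cmle A m) (v := weight D n A S) hD
      (fun m _ => weight_pos hp hD m) (sum_weight hp hD) hT
    have htr : (aggregate D n A S * S).trace =
        ∑ m ∈ D, weight D n A S m * (cmle A m * S).trace := by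
      rw [aggregate, Finset.sum_mul, Matrix.trace_sum]; simp
    simp only [risk, mul_sub, Finset.sum_sub_distrib, htr]
    unfold aggregate
    linarith
  have hprior : ((n : ℝ) / 2)⁻¹ * -Real.log (prior D m₀) ≤
      2 / n * (4 * (m₀.size * Real.log p) + Real.log 2) := by
    rw [inv_div]
    exact mul_le_mul_of_nonneg_left (neg_log_prior_le hp hD m₀) (by positivity)
  exact hconv.trans (hgibbs.trans (by linarith))

/-- The oracle inequality for the aggregate on the event that the rows of `S - Σ` have
`ℓ¹`-norm at most `B`. -/
theorem KL_aggregate_sub_le (hp : 2 ≤ p) {D : Finset (Pattern p)} (hD : D.Nonempty) {n : ℕ}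
    (hn : 0 < n) {A S Sig : Matrix (Fin p) (Fin p) ℝ} (hT : ∀ m ∈ D, (cmle A m).PosDef)
    {B τ : ℝ} (hB0 : 0 ≤ B) (hsymm : ∀ i j, S i j - Sig i j = S j i - Sig j i)
    (hB : ∀ i, ∑ j, |S i j - Sig i j| ≤ B) (hτ : ∀ m ∈ D, (cmle A m).trace ≤ τ)
    {m₀ : Pattern p} (hm₀ : m₀ ∈ D) :
    KL Sig (aggregate D n A S) - KL Sig (cmle A m₀) ≤
      2 / n * (4 * (m₀.size * Real.log p) + Real.log 2) + 2 * (τ * B) := by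
  have hmain := risk_aggregate_le hp hD hn (S := S) hT hm₀
  have hagg : (aggregate D n A S).PosDef :=
    posDef_sum_smul hD (fun m _ => weight_pos hp hD m) hT
  have haggtr : (aggregate D n A S).trace ≤ τ := by
    rw [aggregate, Matrix.trace_sum]
    calc ∑ m ∈ D, (weight D n A S m • cmle A m).trace
        ≤ ∑ m ∈ D, weight D n A S m * τ := Finset.sum_le_sum fun m hm => by
          rw [Matrix.trace_smul, smul_eq_mul]
          exact mul_le_mul_of_nonneg_left (hτ m hm) (weight_pos hp hD m).le
      _ = τ := by rw [← Finset.sum_mul, sum_weight hp hD, one_mul]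
  -- The exchange of `S` and `Σ` is paid twice, at the aggregate and at `m₀`; the reference risk at
  -- `Σ⁻¹` cancels.
  have hbound : ∀ T : Matrix (Fin p) (Fin p) ℝ, T.PosDef → T.trace ≤ τ →
      |risk S T - risk Sig T| ≤ τ * B := by
    intro T hTpd hTtr
    have h : risk S T - risk Sig T = (T * (S - Sig)).trace := by
      simp [risk, Matrix.mul_sub, Matrix.trace_sub]
    rw [h]
    exact (abs_trace_mul_le hTpd.posSemidef (by simpa using hsymm) (by simpa using hB)).trans
      (mul_le_mul_of_nonneg_right hTtr hB0)
  have h1 := abs_le.1 (hbound _ hagg haggtr)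
  have h2 := abs_le.1 (hbound _ (hT m₀ hm₀) (hτ m₀ hm₀))
  unfold KL
  linarith [h1.1, h2.2]

theorem posDef_cmle {A : Matrix (Fin p) (Fin p) ℝ} {m : Pattern p} (h : ∃ T, IsCMLE A m T) :
    (cmle A m).PosDef := by
  rw [cmle, dif_pos h]
  exact h.choose_spec.1.1

end Oracle

/-! ### Row errors of hard thresholding -/

section Threshold

variable {p : ℕ}

/-- Hard thresholding of a covariance with `ℓ^q`-sparse rows, when the noise is at most half of
the threshold. -/
theorem sum_abs_hardThreshold_sub_le {q δ γ : ℝ} (hq₀ : 0 ≤ q) (hq₁ : q < 1) (hγ : 0 < γ)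
    {A Sig : Matrix (Fin p) (Fin p) ℝ} (hnoise : ∀ i j, |A i j - Sig i j| ≤ γ / 2) {i : Fin p}
    (hrow : ∑ j, (open Classical in if Sig i j = 0 then 0 else |Sig i j| ^ q) ≤ δ) :
    ∑ j, |hardThreshold γ A i j - Sig i j| ≤ (2 * γ) ^ (1 - q) * δ := by
  classical
  have hq : 0 ≤ 1 - q := by linarith
  have key : ∀ j, |hardThreshold γ A i j - Sig i j| ≤
      (2 * γ) ^ (1 - q) * (if Sig i j = 0 then 0 else |Sig i j| ^ q) := by
    intro j
    have hn := hnoise i j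
    have habs' := abs_sub_abs_le_abs_sub (Sig i j) (A i j)
    rw [abs_sub_comm (Sig i j)] at habs'
    simp only [hardThreshold, Matrix.of_apply]
    split_ifs with h1 h2 h2
    -- A zero entry is never kept: `γ ≤ |A i j| ≤ γ / 2` is absurd.
    · rw [h2, sub_zero] at hn; linarith
    · have habs := abs_sub_abs_le_abs_sub (A i j) (Sig i j)
      have hs : γ / 2 ≤ |Sig i j| := by linarith
      calc |A i j - Sig i j| ≤ γ / 2 := hn
        _ = (γ / 2) ^ (1 - q) * (γ / 2) ^ q := by
            rw [← Real.rpow_add (by positivity)]; simp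
        _ ≤ (2 * γ) ^ (1 - q) * |Sig i j| ^ q := by
            gcongr
            linarith
    · simp [h2]
    -- A discarded entry has `|A i j| < γ`, hence `|Sig i j| ≤ 3 γ / 2`.
    · have hs : |Sig i j| ≤ 2 * γ := by linarith
      have hpos : 0 < |Sig i j| := abs_pos.2 h2
      calc |0 - Sig i j| = |Sig i j| ^ (1 - q) * |Sig i j| ^ q := by
            rw [← Real.rpow_add hpos]; simp
        _ ≤ (2 * γ) ^ (1 - q) * |Sig i j| ^ q := by gcongr
  calc ∑ j, |hardThreshold γ A i j - Sig i j|
      ≤ ∑ j, (2 * γ) ^ (1 - q) * (if Sig i j = 0 then 0 else |Sig i j| ^ q) :=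
        Finset.sum_le_sum fun j _ => key j
    _ ≤ (2 * γ) ^ (1 - q) * δ := by
        rw [← Finset.mul_sum]
        refine mul_le_mul_of_nonneg_left ?_ (by positivity)
        convert hrow

/-- Thresholding moves an entry by at most `γ`. This uses no sparsity and allows `u` above the
threshold; the factor `p` is harmless when `p` is bounded. -/
theorem sum_abs_hardThreshold_sub_le_card {γ u : ℝ} (hγ : 0 < γ)
    {A Sig : Matrix (Fin p) (Fin p) ℝ} (hnoise : ∀ i j, |A i j - Sig i j| ≤ u) (i : Fin p) :
    ∑ j, |hardThreshold γ A i j - Sig i j| ≤ p * (γ + u) := by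
  have key : ∀ j, |hardThreshold γ A i j - Sig i j| ≤ γ + u := by
    intro j
    have hn := hnoise i j
    have habs' := abs_sub_abs_le_abs_sub (Sig i j) (A i j)
    rw [abs_sub_comm (Sig i j)] at habs'
    simp only [hardThreshold, Matrix.of_apply]
    split_ifs with h1
    · linarith
    · rw [zero_sub, abs_neg]; linarith
  simpa [mul_add] using Finset.sum_le_sum fun j (_ : j ∈ Finset.univ) => key j

theorem hardThreshold_symm {γ : ℝ} {A : Matrix (Fin p) (Fin p) ℝ} (hA : ∀ i j, A i j = A j i)
    (i j : Fin p) : hardThreshold γ A i j = hardThreshold γ A j i := by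
  simp only [hardThreshold, Matrix.of_apply, hA i j]

theorem empCov_symm {n : ℕ} (x : Fin n → EuclideanSpace ℝ (Fin p)) (i j : Fin p) :
    empCov x i j = empCov x j i := by
  simp only [empCov, Matrix.of_apply, mul_comm]

end Threshold

end GES

namespace GES

/-! ### Exponential moments of products of Gaussian coordinates -/

section GaussianMoments

theorem exp_le_one_add_add_sq_mul_exp_abs (x : ℝ) :
    Real.exp x ≤ 1 + x + x ^ 2 * Real.exp |x| := by
  have h := Complex.norm_exp_sub_sum_le_norm_mul_exp (x : ℂ) 2
  simp only [Finset.sum_range_succ, Finset.sum_range_zero, pow_zero, Nat.factorial_zero,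
    Nat.cast_one, div_one, zero_add, pow_one, Nat.factorial_one, Complex.norm_real] at h
  rw [← Complex.ofReal_exp, ← Complex.ofReal_one, ← Complex.ofReal_add, ← Complex.ofReal_sub,
    Complex.norm_real, Real.norm_eq_abs, Real.norm_eq_abs, sq_abs] at h
  linarith [le_abs_self (Real.exp x - (1 + x))]

theorem abs_mul_le_of_abs_le {b θ : ℝ} (hθ : |θ| ≤ b / 2) (x y : ℝ) :
    |θ * (x * y)| ≤ b * (x ^ 2 + y ^ 2) / 4 := by
  have h1 : |x * y| ≤ (x ^ 2 + y ^ 2) / 2 := by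
    rw [abs_le]; constructor <;> nlinarith [sq_nonneg (x + y), sq_nonneg (x - y)]
  rw [abs_mul]
  calc |θ| * |x * y| ≤ b / 2 * ((x ^ 2 + y ^ 2) / 2) :=
        mul_le_mul hθ h1 (abs_nonneg _) ((abs_nonneg _).trans hθ)
    _ = _ := by ring

theorem exp_half_add_le (s t : ℝ) : Real.exp ((s + t) / 2) ≤ (Real.exp s + Real.exp t) / 2 := by
  have h : ∀ u : ℝ, Real.exp (u / 2) ^ 2 = Real.exp u := fun u => by
    rw [← Real.exp_nat_mul]; congr 1; push_cast; ring
  rw [add_div, Real.exp_add, ← h s, ← h t]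
  nlinarith [sq_nonneg (Real.exp (s / 2) - Real.exp (t / 2))]

/-- Keeping the linear term exact lets it integrate to `θ Σ_ij`. With `w = b (x² + y²) / 4`, the
remainder is controlled by `w² e^w ≤ 2 e^(2w)` and convexity of `exp`, leaving one-coordinate
moments. -/
theorem exp_mul_mul_le_quadratic {b θ : ℝ} (hb : 0 < b) (hθ : |θ| ≤ b / 2) (x y : ℝ) :
    Real.exp (θ * (x * y)) ≤ 1 + θ * (x * y) +
      θ ^ 2 * (4 / b ^ 2 * (Real.exp (b * x ^ 2) + Real.exp (b * y ^ 2))) := by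
  set w := b * (x ^ 2 + y ^ 2) / 4 with hw
  have hw0 : 0 ≤ w := by positivity
  have h0 := exp_le_one_add_add_sq_mul_exp_abs (θ * (x * y))
  have h1 := abs_mul_le_of_abs_le hθ x y
  have hsq : b ^ 2 * (x * y) ^ 2 ≤ 4 * w ^ 2 := by
    have : (x * y) ^ 2 ≤ ((x ^ 2 + y ^ 2) / 2) ^ 2 := by nlinarith [sq_nonneg (x ^ 2 - y ^ 2)]
    have := mul_le_mul_of_nonneg_left this (sq_nonneg b)
    rw [hw]; nlinarith
  have hexpw : w ^ 2 ≤ 2 * Real.exp w := by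
    have := Real.quadratic_le_exp_of_nonneg hw0
    linarith
  have hexp2 : Real.exp w * Real.exp w ≤ (Real.exp (b * x ^ 2) + Real.exp (b * y ^ 2)) / 2 := by
    rw [← Real.exp_add]
    convert exp_half_add_le (b * x ^ 2) (b * y ^ 2) using 2
    rw [hw]; ring
  have hkey : (x * y) ^ 2 * Real.exp |θ * (x * y)| ≤
      4 / b ^ 2 * (Real.exp (b * x ^ 2) + Real.exp (b * y ^ 2)) := by
    rw [div_mul_eq_mul_div, le_div_iff₀ (by positivity)]
    calc (x * y) ^ 2 * Real.exp |θ * (x * y)| * b ^ 2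
        ≤ (x * y) ^ 2 * Real.exp w * b ^ 2 := by gcongr
      _ = (b ^ 2 * (x * y) ^ 2) * Real.exp w := by ring
      _ ≤ (4 * w ^ 2) * Real.exp w := by gcongr
      _ ≤ (4 * (2 * Real.exp w)) * Real.exp w := by gcongr
      _ ≤ _ := by linarith
  have := mul_le_mul_of_nonneg_left hkey (sq_nonneg θ)
  calc _ ≤ _ := h0
    _ = 1 + θ * (x * y) + θ ^ 2 * ((x * y) ^ 2 * Real.exp |θ * (x * y)|) := by ring
    _ ≤ _ := by linarith

/-- The exponent is half the critical value `1 / (2v)`, so a Gaussian kernel of variance `2v`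
remains, with total integral `√2`. -/
theorem gaussianPDFReal_mul_exp_sq {v : NNReal} (hv : v ≠ 0) (x : ℝ) :
    gaussianPDFReal 0 v x * Real.exp ((4 * (v : ℝ))⁻¹ * x ^ 2) =
      (√(2 * Real.pi * v))⁻¹ * Real.exp (-(4 * (v : ℝ))⁻¹ * x ^ 2) := by
  have hv' : (v : ℝ) ≠ 0 := by exact_mod_cast hv
  rw [gaussianPDFReal, mul_assoc, ← Real.exp_add]
  congr 2
  field_simp
  ring

theorem integrable_exp_sq_gaussianReal {v : NNReal} (hv : v ≠ 0) :
    Integrable (fun x : ℝ => Real.exp ((4 * (v : ℝ))⁻¹ * x ^ 2)) (gaussianReal 0 v) := by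
  have hv' : (0 : ℝ) < v := by exact_mod_cast pos_iff_ne_zero.2 hv
  rw [gaussianReal_of_var_ne_zero _ hv, integrable_withDensity_iff_integrable_smul'
    (measurable_gaussianPDF _ _) (ae_of_all _ fun _ => gaussianPDF_lt_top)]
  simp only [toReal_gaussianPDF, smul_eq_mul, gaussianPDFReal_mul_exp_sq hv]
  exact (integrable_exp_neg_mul_sq (by positivity)).const_mul _

theorem integral_exp_sq_gaussianReal_le {v : NNReal} (hv : v ≠ 0) :
    ∫ x, Real.exp ((4 * (v : ℝ))⁻¹ * x ^ 2) ∂(gaussianReal 0 v) ≤ 2 := by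
  have hv' : (0 : ℝ) < v := by exact_mod_cast pos_iff_ne_zero.2 hv
  rw [integral_gaussianReal_eq_integral_smul hv]
  simp only [smul_eq_mul, gaussianPDFReal_mul_exp_sq hv]
  rw [integral_const_mul, integral_gaussian, inv_mul_le_iff₀ (by positivity)]
  rw [Real.sqrt_le_left (by positivity), mul_pow, Real.sq_sqrt (by positivity), div_inv_eq_mul]
  nlinarith [mul_pos Real.pi_pos hv']

variable {p : ℕ} {Sig : Matrix (Fin p) (Fin p) ℝ}

theorem exp_sq_eval_multivariateGaussian (hS : Sig.PosDef) {M : ℝ} {i : Fin p}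
    (hM : Sig i i ≤ M) :
    Integrable (fun x : EuclideanSpace ℝ (Fin p) => Real.exp ((4 * M)⁻¹ * x i ^ 2))
      (multivariateGaussian 0 Sig) ∧
    ∫ x, Real.exp ((4 * M)⁻¹ * x i ^ 2) ∂(multivariateGaussian 0 Sig) ≤ 2 := by
  have hpos : 0 < Sig i i := hS.diag_pos
  have hv : (Sig i i).toNNReal ≠ 0 := by simpa using hpos
  have hc : ((Sig i i).toNNReal : ℝ) = Sig i i := Real.coe_toNNReal _ hpos.le
  have hmp := measurePreserving_eval_multivariateGaussian (μ := 0) hS.posSemidef (i := i)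
  have hint := (integrable_exp_sq_gaussianReal hv)
  have hle := integral_exp_sq_gaussianReal_le hv
  rw [hc] at hint hle
  simp only [PiLp.zero_apply] at hmp
  have hdom : ∀ y : ℝ, Real.exp ((4 * M)⁻¹ * y ^ 2) ≤ Real.exp ((4 * Sig i i)⁻¹ * y ^ 2) := by
    intro y; gcongr
  have hint' : Integrable (fun y : ℝ => Real.exp ((4 * M)⁻¹ * y ^ 2))
      (gaussianReal 0 (Sig i i).toNNReal) :=
    hint.mono' (by fun_prop) (ae_of_all _ fun y => by
      rw [Real.norm_eq_abs, abs_of_pos (Real.exp_pos _)]; exact hdom y)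
  refine ⟨hmp.integrable_comp_of_integrable hint', ?_⟩
  have hmap : ∫ x : EuclideanSpace ℝ (Fin p), Real.exp ((4 * M)⁻¹ * x i ^ 2)
      ∂(multivariateGaussian 0 Sig) =
      ∫ y, Real.exp ((4 * M)⁻¹ * y ^ 2) ∂(gaussianReal 0 (Sig i i).toNNReal) := by
    rw [← hmp.map_eq, integral_map hmp.measurable.aemeasurable (by fun_prop)]
  rw [hmap]
  exact (integral_mono hint' hint hdom).trans hle

theorem integral_eval_multivariateGaussian (hS : Sig.PosSemidef) (i : Fin p) :
    ∫ x, x i ∂(multivariateGaussian 0 Sig) = 0 := by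
  have hmp := measurePreserving_eval_multivariateGaussian (μ := 0) hS (i := i)
  simp only [PiLp.zero_apply] at hmp
  have h := integral_map (μ := multivariateGaussian 0 Sig) (f := fun y : ℝ => y)
    hmp.measurable.aemeasurable (by fun_prop)
  rw [← h, hmp.map_eq, integral_id_gaussianReal]

theorem integral_mul_eval_multivariateGaussian (hS : Sig.PosSemidef) (i j : Fin p) :
    ∫ x, x i * x j ∂(multivariateGaussian 0 Sig) = Sig i j := by
  rw [← covariance_eval_multivariateGaussian (μ := 0) hS i j, covariance]
  simp [integral_eval_multivariateGaussian hS]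

/-- The product of two coordinates of a centred Gaussian vector is subexponential. -/
theorem exp_mul_eval_multivariateGaussian (hS : Sig.PosDef) {M : ℝ} (hM : 0 < M)
    (hdiag : ∀ i, Sig i i ≤ M) {θ : ℝ} (hθ : |θ| ≤ (8 * M)⁻¹) (i j : Fin p) :
    Integrable (fun x : EuclideanSpace ℝ (Fin p) => Real.exp (θ * (x i * x j)))
      (multivariateGaussian 0 Sig) ∧
    ∫ x, Real.exp (θ * (x i * x j)) ∂(multivariateGaussian 0 Sig) ≤
      Real.exp (θ * Sig i j + 256 * M ^ 2 * θ ^ 2) := by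
  set b := (4 * M)⁻¹ with hbdef
  have hb : 0 < b := by positivity
  have hθ' : |θ| ≤ b / 2 := hθ.trans_eq (by rw [hbdef]; field_simp; norm_num)
  obtain ⟨hi, hi2⟩ := exp_sq_eval_multivariateGaussian hS (hdiag i)
  obtain ⟨hj, hj2⟩ := exp_sq_eval_multivariateGaussian hS (hdiag j)
  rw [← hbdef] at hi hi2 hj hj2
  have hsum := hi.add hj
  have hexp : Integrable (fun x : EuclideanSpace ℝ (Fin p) => Real.exp (θ * (x i * x j)))
      (multivariateGaussian 0 Sig) := by
    refine hsum.mono' (by fun_prop) (ae_of_all _ fun x => ?_)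
    rw [Real.norm_eq_abs, abs_of_pos (Real.exp_pos _), Pi.add_apply]
    have h1 := (le_abs_self _).trans (abs_mul_le_of_abs_le hθ' (x i) (x j))
    have h2 := exp_half_add_le (b * x i ^ 2) (b * x j ^ 2)
    have h3 : Real.exp (θ * (x i * x j)) ≤ Real.exp ((b * x i ^ 2 + b * x j ^ 2) / 2) := by
      apply Real.exp_le_exp.2
      have : 0 ≤ b * x i ^ 2 + b * x j ^ 2 := by positivity
      linarith
    linarith [Real.exp_pos (b * x i ^ 2), Real.exp_pos (b * x j ^ 2)]
  have hmul : Integrable (fun x : EuclideanSpace ℝ (Fin p) => x i * x j)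
      (multivariateGaussian 0 Sig) := by
    refine (hsum.const_mul (b⁻¹)).mono' (by fun_prop) (ae_of_all _ fun x => ?_)
    rw [Real.norm_eq_abs, Pi.add_apply, ← div_eq_inv_mul, le_div_iff₀ hb]
    have h1 := Real.add_one_le_exp (b * x i ^ 2)
    have h2 := Real.add_one_le_exp (b * x j ^ 2)
    have h3 : |x i * x j| ≤ x i ^ 2 + x j ^ 2 := by
      rw [abs_le]; constructor <;>
        nlinarith [sq_nonneg (x i + x j), sq_nonneg (x i - x j), sq_nonneg (x i), sq_nonneg (x j)]
    nlinarith
  refine ⟨hexp, ?_⟩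
  have hquad : Integrable (fun x : EuclideanSpace ℝ (Fin p) =>
      θ ^ 2 * (4 / b ^ 2 * (Real.exp (b * x i ^ 2) + Real.exp (b * x j ^ 2))))
      (multivariateGaussian 0 Sig) := (hsum.const_mul _).const_mul _
  have hlin : Integrable (fun x : EuclideanSpace ℝ (Fin p) => 1 + θ * (x i * x j))
      (multivariateGaussian 0 Sig) := (integrable_const _).add (hmul.const_mul _)
  calc ∫ x, Real.exp (θ * (x i * x j)) ∂(multivariateGaussian 0 Sig)
      ≤ ∫ x, (1 + θ * (x i * x j) +
          θ ^ 2 * (4 / b ^ 2 * (Real.exp (b * x i ^ 2) + Real.exp (b * x j ^ 2))))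
          ∂(multivariateGaussian 0 Sig) :=
        integral_mono hexp (hlin.add hquad) fun x => exp_mul_mul_le_quadratic hb hθ' (x i) (x j)
    _ = 1 + θ * Sig i j + θ ^ 2 * (4 / b ^ 2 *
          (∫ x, Real.exp (b * x i ^ 2) ∂(multivariateGaussian 0 Sig) +
            ∫ x, Real.exp (b * x j ^ 2) ∂(multivariateGaussian 0 Sig))) := by
        rw [integral_add hlin hquad, integral_add (integrable_const _) (hmul.const_mul _),
          integral_const_mul, integral_const_mul, integral_const_mul, integral_add hi hj,
          integral_mul_eval_multivariateGaussian hS.posSemidef]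
        simp
    -- Both moments are at most `2`, and `16 / b² = 256 M²` for `b = 1 / (4M)`.
    _ ≤ 1 + θ * Sig i j + θ ^ 2 * (4 / b ^ 2 * (2 + 2)) := by gcongr
    _ = θ * Sig i j + 256 * M ^ 2 * θ ^ 2 + 1 := by rw [hbdef]; field_simp; ring
    _ ≤ _ := Real.add_one_le_exp _

end GaussianMoments

/-! ### Chernoff and union bounds for the empirical covariance -/

section Concentration

variable {p n : ℕ} {Sig : Matrix (Fin p) (Fin p) ℝ}

/-- Chernoff bound for one tail of an empirical covariance; the sign `s` selects the tail. -/
theorem measureReal_empCov_tail_le (hS : Sig.PosDef) {M : ℝ} (hM : 0 < M)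
    (hdiag : ∀ i, Sig i i ≤ M) (hn : 0 < n) {u : ℝ} (hu0 : 0 ≤ u) (hu : u ≤ 64 * M) {s : ℝ}
    (hs : s ^ 2 = 1) (i j : Fin p) :
    (Measure.pi fun _ : Fin n => multivariateGaussian 0 Sig).real
      {x | u ≤ s * (empCov x i j - Sig i j)} ≤ Real.exp (-(n * u ^ 2 / (1024 * M ^ 2))) := by
  have hn' : (0 : ℝ) < n := by exact_mod_cast hn
  have hsabs : |s| = 1 := by
    rcases (show s = 1 ∨ s = -1 by simpa using hs) with h | h <;> simp [h]
  -- The minimizer of `-η u + 256 M² η²`, with value `-u² / (1024 M²)`; `u ≤ 64 M` is exactly `η ≤ 1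
  -- / (8M)`.
  set η := u / (512 * M ^ 2) with hη
  have hη0 : 0 ≤ η := by positivity
  have hθ : |s * η| ≤ (8 * M)⁻¹ := by
    rw [abs_mul, hsabs, one_mul, abs_of_nonneg hη0, hη, div_le_iff₀ (by positivity)]
    calc u ≤ 64 * M := hu
      _ = _ := by field_simp; norm_num
  obtain ⟨hint, hle⟩ := exp_mul_eval_multivariateGaussian hS hM hdiag hθ i j
  set μ := Measure.pi fun _ : Fin n => multivariateGaussian (0 : EuclideanSpace ℝ (Fin p)) Sig
  set f : (Fin n → EuclideanSpace ℝ (Fin p)) → ℝ :=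
    fun x => ∏ k, Real.exp (s * η * (x k i * x k j)) with hf
  have hfint : Integrable f μ :=
    Integrable.fintype_prod (f := fun _ (y : EuclideanSpace ℝ (Fin p)) =>
      Real.exp (s * η * (y i * y j))) fun _ => hint
  have hfle : ∫ x, f x ∂μ ≤ Real.exp (n * (s * η * Sig i j + 256 * M ^ 2 * (s * η) ^ 2)) := by
    have h := integral_fintype_prod_eq_pow (ι := Fin n)
      (fun y : EuclideanSpace ℝ (Fin p) => Real.exp (s * η * (y i * y j)))
      (μ := multivariateGaussian (0 : EuclideanSpace ℝ (Fin p)) Sig)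
    rw [Fintype.card_fin] at h
    rw [hf, h, Real.exp_nat_mul]
    exact pow_le_pow_left₀ (integral_nonneg fun _ => (Real.exp_pos _).le) hle n
  have hfexp : ∀ x, f x = Real.exp (s * η * (n * empCov x i j)) := by
    intro x
    simp only [hf, ← Real.exp_sum, ← Finset.mul_sum, empCov, Matrix.of_apply]
    rw [← mul_assoc (n : ℝ), mul_inv_cancel₀ hn'.ne', one_mul]
  set c := Real.exp (n * (η * u + s * η * Sig i j)) with hc
  have hsub : {x | u ≤ s * (empCov x i j - Sig i j)} ⊆ {x | c ≤ f x} := by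
    intro x hx
    simp only [Set.mem_ofPred_eq] at hx ⊢
    rw [hfexp, hc, Real.exp_le_exp]
    have := mul_le_mul_of_nonneg_left hx (mul_nonneg hn'.le hη0)
    linarith
  have hmarkov := mul_meas_ge_le_integral_of_nonneg (μ := μ) (f := f)
    (ae_of_all _ fun x => by rw [hfexp]; exact (Real.exp_pos _).le) hfint c
  have hreal : μ.real {x | c ≤ f x} ≤
      Real.exp (n * (s * η * Sig i j + 256 * M ^ 2 * (s * η) ^ 2)) / c := by
    rw [le_div_iff₀ (Real.exp_pos _), mul_comm]
    exact hmarkov.trans hfle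
  refine (measureReal_mono hsub).trans (hreal.trans_eq ?_)
  rw [hc, ← Real.exp_sub, mul_pow, hs, hη]
  congr 1
  field_simp
  ring

theorem measureReal_abs_empCov_sub_le (hS : Sig.PosDef) {M : ℝ} (hM : 0 < M)
    (hdiag : ∀ i, Sig i i ≤ M) (hn : 0 < n) {u : ℝ} (hu0 : 0 ≤ u) (hu : u ≤ 64 * M)
    (i j : Fin p) :
    (Measure.pi fun _ : Fin n => multivariateGaussian 0 Sig).real
      {x | u ≤ |empCov x i j - Sig i j|} ≤ 2 * Real.exp (-(n * u ^ 2 / (1024 * M ^ 2))) := by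
  have hsub : {x : Fin n → EuclideanSpace ℝ (Fin p) | u ≤ |empCov x i j - Sig i j|} ⊆
      {x | u ≤ 1 * (empCov x i j - Sig i j)} ∪ {x | u ≤ (-1) * (empCov x i j - Sig i j)} := by
    intro x hx
    simpa [le_abs] using hx
  refine (measureReal_mono hsub).trans ((measureReal_union_le _ _).trans ?_)
  have h1 := measureReal_empCov_tail_le hS hM hdiag hn hu0 hu (one_pow 2) i j
  have h2 := measureReal_empCov_tail_le hS hM hdiag hn hu0 hu (s := -1) (by norm_num) i j
  linarith

/-- Uniform concentration of the entries of an empirical covariance matrix. -/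
theorem measureReal_exists_abs_empCov_sub_le (hS : Sig.PosDef) {M : ℝ} (hM : 0 < M)
    (hdiag : ∀ i, Sig i i ≤ M) (hn : 0 < n) {u : ℝ} (hu0 : 0 ≤ u) (hu : u ≤ 64 * M) :
    (Measure.pi fun _ : Fin n => multivariateGaussian 0 Sig).real
      {x | ∃ i j, u ≤ |empCov x i j - Sig i j|} ≤
      2 * p ^ 2 * Real.exp (-(n * u ^ 2 / (1024 * M ^ 2))) := by
  have hset : {x : Fin n → EuclideanSpace ℝ (Fin p) | ∃ i j, u ≤ |empCov x i j - Sig i j|} =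
      ⋃ e : Fin p × Fin p, {x | u ≤ |empCov x e.1 e.2 - Sig e.1 e.2|} := by
    ext x; simp
  rw [hset]
  refine (measureReal_iUnion_fintype_le _).trans
    ((Finset.sum_le_sum fun e _ => measureReal_abs_empCov_sub_le hS hM hdiag hn hu0 hu _ _).trans
      (le_of_eq ?_))
  simp
  ring

end Concentration

end GES

namespace GES

/-! ### Choice of the noise level and collection of rates -/

section Rate

/-- A noise level that the empirical covariance exceeds with probability at most `ε / 2`, and below
which the rows of the thresholding error are of the claimed order. For large `p` the level is a
fixed fraction of the threshold; for bounded `p` it may exceed the threshold. -/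
theorem exists_noise_level {q δ M K L a ε : ℝ} (hq₀ : 0 ≤ q) (hq₁ : q < 1) (hM : 0 < M)
    (hK : 128 * M ≤ K) (hL : 0 ≤ L) (hLε : Real.exp (-L) ≤ ε / 4) (ha0 : 0 ≤ a)
    (ha : a ^ 2 = 1024 * M ^ 2 * (2 + 2 * L)) {p n : ℕ} (hp : 2 ≤ p) (hn : 0 < n)
    (hx1 : Real.log p / n ≤ 1) (hxa : a * √(Real.log p / n) ≤ 64 * M)
    {Sig : Matrix (Fin p) (Fin p) ℝ} (hS : Sig ∈ covClass p q δ M) :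
    ∃ u : ℝ, 0 ≤ u ∧ u ≤ 64 * M ∧
      2 * p ^ 2 * Real.exp (-(n * u ^ 2 / (1024 * M ^ 2))) ≤ ε / 2 ∧
      ∀ A : Matrix (Fin p) (Fin p) ℝ, (∀ i j, |A i j - Sig i j| ≤ u) → ∀ i,
        ∑ j, |hardThreshold (K * √(Real.log p / n)) A i j - Sig i j| ≤
          ((2 * K) ^ (1 - q) * |δ| + Real.exp (L / 2) * (K + a)) *
            (Real.log p / n) ^ ((1 - q) / 2) := by
  have hn' : (0 : ℝ) < n := by exact_mod_cast hn
  have hp' : (2 : ℝ) ≤ p := by exact_mod_cast hp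
  have hppos : (0 : ℝ) < p := by linarith
  have hlog : 1 / 2 ≤ Real.log p := by
    have := Real.log_le_log (by norm_num) hp'
    linarith [Real.log_two_gt_d9]
  set x := Real.log p / n with hx
  have hx0 : 0 < x := by positivity
  have hnx : n * x = Real.log p := by rw [hx]; field_simp
  set r := √x with hr
  have hr0 : 0 < r := Real.sqrt_pos.2 hx0
  have hr2 : r ^ 2 = x := Real.sq_sqrt hx0.le
  have hr1 : r ≤ 1 := Real.sqrt_le_one.2 hx1
  have hKpos : 0 < K := by linarith
  have hrρ : r ^ (1 - q) = x ^ ((1 - q) / 2) := by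
    rw [hr, Real.sqrt_eq_rpow, ← Real.rpow_mul hx0.le]; congr 1; ring
  have hrle : r ≤ x ^ ((1 - q) / 2) := by
    rw [← hrρ]
    exact (Real.rpow_one r).symm.trans_le
      (Real.rpow_le_rpow_of_exponent_ge hr0 hr1 (by linarith))
  set ρ := x ^ ((1 - q) / 2) with hρ
  have hρ0 : 0 < ρ := by positivity
  have hp2 : ∀ c : ℝ, 2 * (p : ℝ) ^ 2 * Real.exp (-(c * Real.log p)) =
      2 * Real.exp (-((c - 2) * Real.log p)) := by
    intro c
    nth_rewrite 1 [← Real.exp_log hppos]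
    rw [← Real.exp_nat_mul, mul_assoc, ← Real.exp_add]
    congr 2; push_cast; ring
  have hexp : ∀ c : ℝ, L ≤ (c - 2) * Real.log p →
      2 * (p : ℝ) ^ 2 * Real.exp (-(c * Real.log p)) ≤ ε / 2 := by
    intro c hc
    rw [hp2]
    have := Real.exp_le_exp.2 (neg_le_neg hc)
    linarith
  have hterm1 : 0 ≤ (2 * K) ^ (1 - q) * |δ| := by positivity
  have hterm2 : 0 ≤ Real.exp (L / 2) * (K + a) := by positivity
  rcases le_total L (2 * Real.log p) with hcase | hcase
  -- `128 M ≤ K` puts this level below half the threshold; the tail is `2 p^(-2) ≤ 2 e^(-L)`.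
  · refine ⟨64 * M * r, by positivity, by nlinarith, ?_, fun A hA i => ?_⟩
    · have : n * (64 * M * r) ^ 2 / (1024 * M ^ 2) = 4 * Real.log p := by
        rw [mul_pow, hr2, ← hnx]; field_simp; norm_num
      rw [this]
      exact hexp 4 (by linarith)
    · have h := sum_abs_hardThreshold_sub_le hq₀ hq₁ (mul_pos hKpos hr0) (A := A) (Sig := Sig)
        (fun i j => (hA i j).trans (by nlinarith)) (hS.2 i).2
      calc _ ≤ _ := h
        _ = (2 * K) ^ (1 - q) * δ * ρ := by
            rw [← mul_assoc, Real.mul_rpow (by positivity) hr0.le, hrρ]; ring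
        _ ≤ (2 * K) ^ (1 - q) * |δ| * ρ := by gcongr; exact le_abs_self δ
        _ ≤ _ := by gcongr; linarith
  -- Here `p ≤ e^(L / 2)`. The choice of `a` gives the tail `2 p^(-2L)`, at most `2 e^(-L)` since
  -- `log p ≥ 1 / 2`.
  · refine ⟨a * r, by positivity, hxa, ?_, fun A hA i => ?_⟩
    · have : n * (a * r) ^ 2 / (1024 * M ^ 2) = (2 + 2 * L) * Real.log p := by
        rw [mul_pow, hr2, ← hnx, ha]; field_simp
      rw [this]
      exact hexp _ (by nlinarith)
    · have hple : (p : ℝ) ≤ Real.exp (L / 2) := by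
        rw [← Real.exp_log hppos]; exact Real.exp_le_exp.2 (by linarith)
      calc _ ≤ _ := sum_abs_hardThreshold_sub_le_card (mul_pos hKpos hr0) hA i
        _ = p * (K + a) * r := by ring
        _ ≤ Real.exp (L / 2) * (K + a) * ρ := by gcongr
        _ ≤ _ := by gcongr; linarith

theorem prior_cost_add_noise_cost_le {q s C₁ C₂ : ℝ} (hq₀ : 0 ≤ q) {p n : ℕ}
    (hp : 2 ≤ p) (hn : 0 < n) (hx1 : Real.log p / n ≤ 1) (hs : 0 ≤ s) (hC₁ : 0 ≤ C₁)
    (hC₂ : 0 ≤ C₂) :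
    2 / n * (4 * (s * Real.log p) + Real.log 2) +
        2 * (C₁ * p * (C₂ * (Real.log p / n) ^ ((1 - q) / 2))) ≤
      (9 + 2 * (C₁ * C₂)) *
        (s * Real.log p / n + p * (Real.log p / n) ^ ((1 - q) / 2)) := by
  have hn' : (0 : ℝ) < n := by exact_mod_cast hn
  have hp' : (2 : ℝ) ≤ p := by exact_mod_cast hp
  have hlog : Real.log 2 ≤ Real.log p := Real.log_le_log (by norm_num) hp'
  have hlog0 : 0 < Real.log 2 := Real.log_pos (by norm_num)
  have hx0 : 0 < Real.log p / n := div_pos (by linarith) hn'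
  have hxρ : Real.log p / n ≤ (Real.log p / n) ^ ((1 - q) / 2) :=
    (Real.rpow_one _).symm.trans_le
      (Real.rpow_le_rpow_of_exponent_ge hx0 hx1 (by linarith))
  set ρ := (Real.log p / n) ^ ((1 - q) / 2)
  -- The normalizer's cost goes into the second rate term, since the first vanishes when `s = 0`.
  have h2 : 2 / n * Real.log 2 ≤ p * ρ := by
    calc 2 / n * Real.log 2 ≤ 2 / n * Real.log p := by gcongr
      _ = 2 * (Real.log p / n) := by ring
      _ ≤ p * ρ := by gcongr
  have hb : 0 ≤ s * Real.log p / n := div_nonneg (mul_nonneg hs (by linarith)) hn'.le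
  have hpρ : 0 ≤ (p : ℝ) * ρ := by positivity
  have h3 : 0 ≤ C₁ * C₂ * (s * Real.log p / n) := by positivity
  have h4 : 2 / n * (4 * (s * Real.log p)) = 8 * (s * Real.log p / n) := by ring
  have h5 : 2 * (C₁ * p * (C₂ * ρ)) = 2 * (C₁ * C₂) * (p * ρ) := by ring
  rw [mul_add, h4, h5]
  linarith

end Rate

/-! ### Failure probability at fixed dimensions -/

section Probability

theorem sampleLaw_snd_preimage {p n₁ n₂ : ℕ} (Sig : Matrix (Fin p) (Fin p) ℝ)
    (s : Set (Fin n₂ → EuclideanSpace ℝ (Fin p))) :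
    sampleLaw p n₁ n₂ Sig (Prod.snd ⁻¹' s) =
      (Measure.pi fun _ : Fin n₂ => multivariateGaussian 0 Sig) s := by
  rw [sampleLaw, ← Set.univ_prod, Measure.prod_prod, measure_univ, one_mul]

/-- The probability bound for fixed dimensions: outside the events that some individual estimator
fails to exist, that the traces are large, or that the noise exceeds the level `u`, the
oracle inequality holds. -/
theorem sampleLaw_oracle_failure_le {p n₁ n₂ : ℕ} (hp : 2 ≤ p) (hn : 0 < n₂)
    {D : Finset (Pattern p)} (hD : D.Nonempty) {Sig : Matrix (Fin p) (Fin p) ℝ} (hS : Sig.PosDef)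
    {M : ℝ} (hM : 0 < M) (hdiag : ∀ i, Sig i i ≤ M)
    (hex : ∀ᵐ x ∂(sampleLaw p n₁ n₂ Sig), ∀ m ∈ D, ∃! T, IsCMLE (empCov x.1) m T)
    {ε τ B u γ : ℝ} (hε : 0 < ε)
    (htr : sampleLaw p n₁ n₂ Sig {x | τ < D.sup' hD fun m => (indiv x m).trace} ≤
      ENNReal.ofReal (ε / 2))
    (hB0 : 0 ≤ B) (hu0 : 0 ≤ u) (hu : u ≤ 64 * M)
    (htail : 2 * p ^ 2 * Real.exp (-(n₂ * u ^ 2 / (1024 * M ^ 2))) ≤ ε / 2)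
    (hB : ∀ A : Matrix (Fin p) (Fin p) ℝ, (∀ i j, |A i j - Sig i j| ≤ u) → ∀ i,
      ∑ j, |hardThreshold γ A i j - Sig i j| ≤ B)
    {mstar : Sample p n₁ n₂ → Pattern p}
    (hmstar : ∀ x, mstar x ∈ D ∧
      ∀ m ∈ D, KL Sig (indiv x (mstar x)) ≤ KL Sig (indiv x m)) :
    sampleLaw p n₁ n₂ Sig {x |
      2 / n₂ * (4 * ((mstar x).size * Real.log p) + Real.log 2) + 2 * (τ * B) <
        KL Sig (gES D γ x) - D.inf' hD fun m => KL Sig (indiv x m)} ≤ ENNReal.ofReal ε := by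
  set μ := sampleLaw p n₁ n₂ Sig
  -- Inclusion and subadditivity suffice, so no measurability of `mstar` or of these events is
  -- needed.
  have hsub : {x : Sample p n₁ n₂ |
      2 / n₂ * (4 * ((mstar x).size * Real.log p) + Real.log 2) + 2 * (τ * B) <
        KL Sig (gES D γ x) - D.inf' hD fun m => KL Sig (indiv x m)} ⊆
      {x | ¬ ∀ m ∈ D, ∃! T, IsCMLE (empCov x.1) m T} ∪
        ({x | τ < D.sup' hD fun m => (indiv x m).trace} ∪
          Prod.snd ⁻¹' {y | ∃ i j, u ≤ |empCov y i j - Sig i j|}) := by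
    intro x hx
    by_contra hcon
    simp only [Set.mem_union, Set.mem_ofPred_eq, Set.mem_preimage, not_or, not_not, not_lt,
      not_exists, not_le, Finset.sup'_le_iff] at hcon hx
    obtain ⟨hx1, hx2, hx3⟩ := hcon
    have hsymm : ∀ i j, Sig i j = Sig j i := fun i j => by
      simpa using (hS.isHermitian.apply i j).symm
    have h := KL_aggregate_sub_le hp hD hn (A := empCov x.1)
      (S := hardThreshold γ (empCov x.2)) (Sig := Sig)
      (fun m hm => posDef_cmle (hx1 m hm).exists) hB0
      (fun i j => by rw [hardThreshold_symm (empCov_symm x.2), hsymm i j])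
      (hB _ fun i j => (hx3 i j).le) hx2 (hmstar x).1
    have hinf : KL Sig (indiv x (mstar x)) ≤ D.inf' hD fun m => KL Sig (indiv x m) :=
      Finset.le_inf' _ _ (hmstar x).2
    unfold gES indiv at hx
    unfold indiv at hinf
    linarith
  have h1 : μ {x | ¬ ∀ m ∈ D, ∃! T, IsCMLE (empCov x.1) m T} = 0 := ae_iff.1 hex
  have h3 : μ (Prod.snd ⁻¹' {y | ∃ i j, u ≤ |empCov y i j - Sig i j|}) ≤
      ENNReal.ofReal (ε / 2) := by
    rw [sampleLaw_snd_preimage, ← ofReal_measureReal]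
    exact ENNReal.ofReal_le_ofReal
      ((measureReal_exists_abs_empCov_sub_le hS hM hdiag hn hu0 hu).trans htail)
  calc _ ≤ _ := measure_mono hsub
    _ ≤ 0 + (ENNReal.ofReal (ε / 2) + ENNReal.ofReal (ε / 2)) :=
        (measure_union_le _ _).trans
          (add_le_add h1.le ((measure_union_le _ _).trans (add_le_add htr h3)))
    _ = ENNReal.ofReal ε := by
        rw [zero_add, ← ENNReal.ofReal_add (by linarith) (by linarith), add_halves]

end Probability

end GES

/-! ### Assembly of the uniform asymptotic bound -/

theorem theorem1 (q δ M : ℝ) (hq₀ : 0 ≤ q) (hq₁ : q < 1) :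
    ∃ K₀ : ℝ, 0 < K₀ ∧ ∀ K : ℝ, K₀ ≤ K →
      ∀ (p n₁ n₂ : ℕ → ℕ)
        (_hp : ∀ t, 2 ≤ p t) (_hn₂ : ∀ t, 0 < n₂ t)
        (_hrate : Tendsto (fun t => Real.log (p t) / (n₂ t : ℝ)) atTop (𝓝 0))
        (D : ∀ t, Finset (GES.Pattern (p t))) (hD : ∀ t, (D t).Nonempty)
        -- the covariance matrices over which everything is uniform
        (S : ∀ t, Set (Matrix (Fin (p t)) (Fin (p t)) ℝ))
        (_hS : ∀ t, S t ⊆ GES.covClass (p t) q δ M)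
        -- the individual estimators exist and are unique
        (_hex : ∀ t, ∀ Sig ∈ S t, ∀ᵐ x ∂(GES.sampleLaw (p t) (n₁ t) (n₂ t) Sig),
          ∀ m ∈ D t, ∃! T, GES.IsCMLE (GES.empCov x.1) m T)
        -- the maximal trace of the individual estimators is `O_P(p)`
        (_htrace : GES.UniformlyLeBigOP S
          (fun t Sig => GES.sampleLaw (p t) (n₁ t) (n₂ t) Sig)
          (fun t _ x => (D t).sup' (hD t) fun m => (GES.indiv x m).trace)
          (fun t _ _ => (p t : ℝ)))
        -- an oracle pattern
        (mstar : ∀ t, Matrix (Fin (p t)) (Fin (p t)) ℝ →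
          GES.Sample (p t) (n₁ t) (n₂ t) → GES.Pattern (p t))
        (_hmstar : ∀ t, ∀ Sig ∈ S t, ∀ x, mstar t Sig x ∈ D t ∧
          ∀ m ∈ D t, GES.KL Sig (GES.indiv x (mstar t Sig x)) ≤ GES.KL Sig (GES.indiv x m)),
        GES.UniformlyLeBigOP S
          (fun t Sig => GES.sampleLaw (p t) (n₁ t) (n₂ t) Sig)
          (fun t Sig x =>
            GES.KL Sig (GES.gES (D t) (K * Real.sqrt (Real.log (p t) / (n₂ t : ℝ))) x)
              - (D t).inf' (hD t) fun m => GES.KL Sig (GES.indiv x m))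
          (fun t Sig x =>
            ((mstar t Sig x).size : ℝ) * Real.log (p t) / (n₂ t : ℝ)
              + (p t : ℝ) * (Real.log (p t) / (n₂ t : ℝ)) ^ ((1 - q) / 2)) := by
  refine ⟨128 * max M 1, by positivity, fun K hK p n₁ n₂ hp hn₂ hrate D hD S hS hex htrace
    mstar hmstar ε hε => ?_⟩
  -- For `M ≤ 0` the class is empty, as diagonal entries are positive; `max M 1` keeps `K₀` positive
  -- in this case.
  rcases le_or_gt M 0 with hM | hM
  · refine ⟨1, one_pos, Eventually.of_forall fun t Sig hSig => absurd hM (not_le.2 ?_)⟩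
    have h := hS t hSig
    exact (h.1.diag_pos (i := ⟨0, by linarith [hp t]⟩)).trans_le (h.2 _).1
  have hKM : 128 * M ≤ K := by linarith [le_max_left M 1]
  have hKpos : 0 < K := by linarith
  obtain ⟨C₁, hC₁, htr⟩ := htrace (ε / 2) (by positivity)
  -- All dependence on `ε` beyond `C₁` enters through `L`, hence through `a` and `C₂` but not `K`.
  set L := |Real.log (ε / 4)| with hL
  have hL0 : 0 ≤ L := abs_nonneg _
  have hLε : Real.exp (-L) ≤ ε / 4 :=
    (Real.exp_le_exp.2 (neg_abs_le _)).trans_eq (Real.exp_log (by positivity))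
  set a := 32 * M * √(2 + 2 * L) with ha
  have ha0 : 0 ≤ a := by positivity
  have ha2 : a ^ 2 = 1024 * M ^ 2 * (2 + 2 * L) := by
    rw [ha, mul_pow, Real.sq_sqrt (by positivity)]; ring
  set C₂ := (2 * K) ^ (1 - q) * |δ| + Real.exp (L / 2) * (K + a)
  have hC₂ : 0 < C₂ := by positivity
  have hlim : Tendsto (fun t => a * √(Real.log (p t) / (n₂ t : ℝ))) atTop (𝓝 0) := by
    simpa using (hrate.sqrt).const_mul a
  refine ⟨9 + 2 * (C₁ * C₂), by positivity, ?_⟩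
  filter_upwards [htr, hrate.eventually_le_const one_pos,
    hlim.eventually_le_const (show (0 : ℝ) < 64 * M by positivity)] with t htr hx1 hxa Sig hSig
  have hclass := hS t hSig
  obtain ⟨u, hu0, hu, htail, hB⟩ := GES.exists_noise_level hq₀ hq₁ hM hKM hL0 hLε ha0 ha2 (hp t)
    (hn₂ t) hx1 hxa hclass
  refine (measure_mono fun x hx => ?_).trans (GES.sampleLaw_oracle_failure_le (hp t) (hn₂ t) (hD t)
    hclass.1 hM (fun i => (hclass.2 i).1) (hex t Sig hSig) hε (htr Sig hSig) (by positivity) hu0 hu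
    htail hB (hmstar t Sig hSig))
  exact (GES.prior_cost_add_noise_cost_le hq₀ (hp t) (hn₂ t) hx1 (Nat.cast_nonneg _) hC₁.le
    hC₂.le).trans_lt hx
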